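/- Conventions. $\{0,1\}^*$ is the set of finite binary strings, $|p|$ is the length of $p$, and $\mathbb{N}^+=\{1,2,3,\dots\}$. A computer is a partial recursive function $C\colon\{0,1\}^*\to\{0,1\}^*$ whose domain is prefix-free (no string in it is a prefix of another string in it). A computer $U$ is optimal if for each computer $C$ there is a constant $\mathrm{sim}(C)$ such that whenever $C(p)$ is defined there is a $p'$ with $U(p')=C(p)$ and $|p'|\le|p|+\mathrm{sim}(C)$. Fix an optimal computer $U$ and put $H(s)=\min\{\,|p| : U(p)=s\,\}$. A function $f\colon\mathbb{N}^+\to[0,\infty)$ is lower-computable if there is a total recursive function $a\colon\mathbb{N}^+\times\mathbb{N}^+\to\mathbb{Q}$ such that, for each $n\in\mathbb{N}^+$, $\lim_{k\to\infty}a(k,n)=f(n)$ and $a(k,n)\le f(n)$ for all $k\in\mathbb{N}^+$. Theorem. Let $A$ be an infinite recursively enumerable subset of $\{0,1\}^*$ and let $f\colon\mathbb{N}^+\to[0,\infty)$ be a lower-computable function such that $\lim_{n\to\infty}f(n)=\infty$. Then the following hold. (i) $\sum_{U(p)\in A}f(|p|)2^{-|p|}$ diverges to $\infty$, where the sum is over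 all $p$ in the domain of $U$ with $U(p)\in A$. (ii) If there exists $l_0\in\mathbb{N}^+$ such that $f(l)2^{-l}$ is a nonincreasing function of $l$ for all $l\ge l_0$, then $\sum_{s\in A}f(H(s))2^{-H(s)}$ diverges to $\infty$. -/

import Mathlib

open Filter Topology
open scoped NNReal ENNReal

namespace AIT

/-- Finite binary strings `{0,1}*`. -/
abbrev BinStr : Type := List Bool

/-- A set of strings is prefix-free if no string in it is a prefix of another string in it. -/
def PrefixFree (S : Set BinStr) : Prop :=
  ∀ p ∈ S, ∀ q ∈ S, p <+: q → p = q

/-- A computer is a partial recursive function from strings to strings whose domain of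
definition is prefix-free. -/
structure IsComputer (C : BinStr →. BinStr) : Prop where
  partrec : Partrec C
  prefixFree : PrefixFree C.Dom

/-- A computer `U` is optimal if it simulates every computer `C` at the cost of a bounded
increase, by a constant depending on `C`, of the length of programs. -/
structure IsOptimal (U : BinStr →. BinStr) : Prop where
  isComputer : IsComputer U
  simulates : ∀ C : BinStr →. BinStr, IsComputer C →
    ∃ sim : ℕ, ∀ p s : BinStr, s ∈ C p → ∃ p' : BinStr, s ∈ U p' ∧ p'.length ≤ p.length + sim

/-- The program-size complexity `H_C(s) = min {|p| : C(p) = s}` with respect to `C`. The set is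
nonempty for every `s` when `C` is optimal (`IsOptimal.exists_program`). -/
noncomputable def complexity (C : BinStr →. BinStr) (s : BinStr) : ℕ :=
  sInf {l : ℕ | ∃ p : BinStr, s ∈ C p ∧ p.length = l}

/-- A total recursive function with rational values: one that can be written as a fraction with
recursive integer numerator and recursive positive denominator. -/
def RecursiveRat {α : Type*} [Primcodable α] (a : α → ℚ) : Prop :=
  ∃ (num : α → ℤ) (den : α → ℕ), Computable num ∧ Computable den ∧
    ∀ x, 0 < den x ∧ a x = (num x : ℚ) / (den x : ℚ)

/-- `f : ℕ⁺ → [0,∞)` is lower-computable: there is a total recursive `a : ℕ⁺ × ℕ⁺ → ℚ` with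
`a(k,n) → f(n)` as `k → ∞`, and `a(k,n) ≤ f(n)` for all `k`. -/
def LowerComputable (f : ℕ+ → ℝ≥0) : Prop :=
  ∃ a : ℕ+ × ℕ+ → ℚ, RecursiveRat a ∧ ∀ n : ℕ+,
    Tendsto (fun k : ℕ+ => (a (k, n) : ℝ)) atTop (𝓝 (f n : ℝ)) ∧
    ∀ k : ℕ+, (a (k, n) : ℝ) ≤ (f n : ℝ)

/-- Every string is the output of some program of an optimal computer. -/
theorem IsOptimal.exists_program {U : BinStr →. BinStr} (hU : IsOptimal U) (s : BinStr) :
    ∃ p : BinStr, s ∈ U p := by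
  let C : BinStr →. BinStr := fun p => bif p.isEmpty then Part.some s else Part.none
  have hC : IsComputer C := by
    refine ⟨?_, ?_⟩
    · refine Partrec.cond ?_ (Computable.const s).partrec Partrec.none
      refine ((Primrec.list_casesOn Primrec.id (Primrec.const true)
        (Primrec.const false).to₂).to_comp).of_eq ?_
      rintro (_ | _) <;> rfl
    · intro p hp q hq _
      have key : ∀ r : BinStr, r ∈ C.Dom → r = [] := by
        rintro (_ | ⟨b, r⟩) hr
        · rfl
        · exact hr.elim
      rw [key p hp, key q hq]
  obtain ⟨sim, h⟩ := hU.simulates C hC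
  obtain ⟨p', hp', -⟩ := h [] s (Part.mem_some s)
  exact ⟨p', hp'⟩

/-- The empty string is not a program of an optimal computer. -/
theorem IsOptimal.length_pos {U : BinStr →. BinStr} (hU : IsOptimal U) {p s : BinStr}
    (hp : s ∈ U p) : 0 < p.length := by
  rcases p with _ | ⟨b, p⟩
  · exfalso
    obtain ⟨q₁, h₁⟩ := hU.exists_program []
    obtain ⟨q₂, h₂⟩ := hU.exists_program [true]
    have hd : ([] : BinStr) ∈ U.Dom := (PFun.mem_dom _ _).2 ⟨s, hp⟩
    have e₁ := hU.isComputer.prefixFree _ hd q₁ ((PFun.mem_dom _ _).2 ⟨_, h₁⟩) List.nil_prefix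
    have e₂ := hU.isComputer.prefixFree _ hd q₂ ((PFun.mem_dom _ _).2 ⟨_, h₂⟩) List.nil_prefix
    rw [← e₁] at h₁
    rw [← e₂] at h₂
    simpa using Part.mem_unique h₁ h₂
  · simp

/-- The program-size complexity with respect to an optimal computer is a positive integer. -/
theorem IsOptimal.complexity_pos {U : BinStr →. BinStr} (hU : IsOptimal U) (s : BinStr) :
    0 < complexity U s := by
  obtain ⟨p, hp⟩ := hU.exists_program s
  have hne : {l : ℕ | ∃ p : BinStr, s ∈ U p ∧ p.length = l}.Nonempty := ⟨_, p, hp, rfl⟩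
  obtain ⟨q, hq, hl⟩ := Nat.sInf_mem hne
  have := hU.length_pos hq
  unfold complexity
  omega

/-- The length of a program of an optimal computer, as a positive integer. -/
def IsOptimal.progLength {U : BinStr →. BinStr} (hU : IsOptimal U) {A : Set BinStr}
    (p : {p : BinStr // ∃ s ∈ A, s ∈ U p}) : ℕ+ :=
  ⟨p.1.length, p.2.elim fun _ h => hU.length_pos h.2⟩

/-- `H(s)` for an optimal computer, as a positive integer. -/
noncomputable def IsOptimal.H {U : BinStr →. BinStr} (hU : IsOptimal U) (s : BinStr) : ℕ+ :=
  ⟨complexity U s, hU.complexity_pos s⟩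

end AIT

/-! Both parts follow from one statement, `tsum_eq_top_of_le`: if `g` dominates `f(|p|) 2^{-|p|}`
for every sufficiently long program `p` of each `s ∈ A`, then `g` has infinite sum over `A`. Suppose
instead that twice the sum is at most `2 ^ d`. Whenever `p` is such a program of `s ∈ A` and `2 ^ n
< f(|p|)`, request for `s` a code word of length about `|p| + d - n`. These requests are recursively
enumerable, because `A` is and because `f` is approximable from below. Each has weight at most `g(s)
2^{-d}`; for a fixed `s` the requested lengths are distinct, so a geometric series bounds their
total by `2 g(s) 2^{-d}`, and the whole weight is at most 1.

The Kraft–Chaitin theorem (`exists_isComputer_of_requests`) turns the requests into a computer, and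
optimality of `U` gives `H(s) ≤ |p| + d - n + O(1)`. As `A` is infinite, it has elements of
arbitrarily large complexity, where `f(H(s))` exceeds any chosen `2 ^ n`. A shortest program `p`
then gives `H(s) < H(s)`.

For (i), `g(s)` sums over all programs of `s`. For (ii), `g(s)` is the term at `H(s)`, corrected on
the finitely many `s` whose complexity lies below the range of monotonicity. -/

namespace AIT

/-! ### Binary values and dyadic intervals -/

/-- The natural number with binary digits `q`, most significant digit first. -/
def binValue (q : BinStr) : ℕ := q.foldl (fun v b => 2 * v + b.toNat) 0

theorem foldl_binary (v : ℕ) (q : BinStr) :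
    q.foldl (fun v b => 2 * v + b.toNat) v = v * 2 ^ q.length + binValue q := by
  induction q generalizing v with
  | nil => simp [binValue]
  | cons b q ih =>
    rw [binValue, List.foldl_cons, List.foldl_cons, ih, ih (2 * 0 + b.toNat), List.length_cons]
    ring

theorem binValue_append (p q : BinStr) :
    binValue (p ++ q) = binValue p * 2 ^ q.length + binValue q := by
  rw [binValue, List.foldl_append, foldl_binary]
  rfl

theorem binValue_singleton (b : Bool) : binValue [b] = b.toNat := by
  simp [binValue]

theorem binValue_lt (q : BinStr) : binValue q < 2 ^ q.length := by
  induction q using List.reverseRecOn with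
  | nil => simp [binValue]
  | append_singleton q b ih =>
    rw [binValue_append, binValue_singleton, List.length_append, pow_add]
    have := b.toNat_le
    simp only [List.length_singleton, pow_one]
    omega

theorem exists_binValue_eq {k l : ℕ} (h : k < 2 ^ l) :
    ∃ q : BinStr, q.length = l ∧ binValue q = k := by
  induction l generalizing k with
  | zero => exact ⟨[], rfl, by simp [binValue]; omega⟩
  | succ l ih =>
    obtain ⟨q, hq, hv⟩ := ih (k := k / 2) (by rw [pow_succ] at h; omega)
    refine ⟨q ++ [k % 2 == 1], by simp [hq], ?_⟩
    rw [binValue_append, binValue_singleton, hv]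
    rcases Nat.mod_two_eq_zero_or_one k with h2 | h2 <;> simp [h2] <;> omega

/-- The left end of the dyadic interval of a string. -/
def leftEnd (q : BinStr) : ℚ := binValue q / 2 ^ q.length

/-- The right end of the dyadic interval of a string. -/
def rightEnd (q : BinStr) : ℚ := (binValue q + 1) / 2 ^ q.length

theorem leftEnd_lt_rightEnd (q : BinStr) : leftEnd q < rightEnd q := by
  unfold leftEnd rightEnd
  gcongr
  linarith

theorem leftEnd_le_of_prefix {p q : BinStr} (h : p <+: q) : leftEnd p ≤ leftEnd q := by
  obtain ⟨r, rfl⟩ := h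
  unfold leftEnd
  rw [binValue_append, List.length_append, pow_add, div_le_div_iff₀ (by positivity) (by positivity)]
  push_cast
  have : (0 : ℚ) ≤ binValue r * 2 ^ p.length := by positivity
  linarith

theorem rightEnd_le_of_prefix {p q : BinStr} (h : p <+: q) : rightEnd q ≤ rightEnd p := by
  obtain ⟨r, rfl⟩ := h
  unfold rightEnd
  rw [binValue_append, List.length_append, pow_add, div_le_div_iff₀ (by positivity) (by positivity)]
  push_cast
  have h1 : (binValue r : ℚ) + 1 ≤ 2 ^ r.length := by exact_mod_cast binValue_lt r
  have := mul_le_mul_of_nonneg_right h1 (show (0 : ℚ) ≤ 2 ^ p.length by positivity)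
  linarith

theorem primrec_binValue : Primrec binValue := by
  refine Primrec.list_foldl Primrec.id (Primrec.const 0) (h := fun _ (x : ℕ × Bool) =>
    2 * x.1 + x.2.toNat) ?_
  exact Primrec.nat_add.comp (Primrec.nat_mul.comp (Primrec.const 2) (Primrec.fst.comp Primrec.snd))
    ((Primrec.dom_finite Bool.toNat).comp (Primrec.snd.comp Primrec.snd))

theorem primrec_two_pow : Primrec fun n : ℕ => 2 ^ n := by
  refine (Primrec.nat_rec₁ 1 (f := fun _ v => 2 * v)
    (Primrec.nat_mul.comp (Primrec.const 2) Primrec.snd)).of_eq fun n => ?_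
  induction n with
  | zero => rfl
  | succ n ih => simp only [pow_succ, ← ih]; ring

/-! ### The Kraft–Chaitin construction -/

/-- The sum of `2⁻ᵐ` over the requests `(s, m)` of an enumeration that precede the `i`-th one, as
the numerator and the binary logarithm of the denominator of a fraction. -/
def requestSum (e : ℕ → Option (BinStr × ℕ)) (i : ℕ) : ℕ × ℕ :=
  Nat.rec (0, 0) (fun j x => (e j).elim x fun r => (x.1 * 2 ^ r.2 + 2 ^ x.2, x.2 + r.2)) i

theorem requestSum_succ (e : ℕ → Option (BinStr × ℕ)) (i : ℕ) :
    requestSum e (i + 1) = (e i).elim (requestSum e i) fun r =>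
      ((requestSum e i).1 * 2 ^ r.2 + 2 ^ (requestSum e i).2, (requestSum e i).2 + r.2) := rfl

theorem computable_requestSum {e : ℕ → Option (BinStr × ℕ)} (he : Computable e) :
    Computable (requestSum e) := by
  have hx : Computable fun y : (ℕ × (ℕ × (ℕ × ℕ))) × (BinStr × ℕ) => y.1.2.2 :=
    Computable.snd.comp (Computable.snd.comp Computable.fst)
  have hm : Computable fun y : (ℕ × (ℕ × (ℕ × ℕ))) × (BinStr × ℕ) => y.2.2 :=
    Computable.snd.comp Computable.snd
  refine Computable.nat_rec Computable.id (Computable.const (0, 0)) (h := fun _ y =>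
    (e y.1).elim y.2 fun r => (y.2.1 * 2 ^ r.2 + 2 ^ y.2.2, y.2.2 + r.2)) ?_
  refine (Computable.option_casesOn (o := fun y : ℕ × (ℕ × (ℕ × ℕ)) => e y.2.1)
    (f := fun y => y.2.2)
    (g := fun y r => (y.2.2.1 * 2 ^ r.2 + 2 ^ y.2.2.2, y.2.2.2 + r.2))
    (he.comp (Computable.fst.comp Computable.snd)) (Computable.snd.comp Computable.snd)
    ?_).of_eq ?_
  · exact Computable.pair
      (Primrec.nat_add.to_comp.comp
        (Primrec.nat_mul.to_comp.comp (Computable.fst.comp hx) (primrec_two_pow.to_comp.comp hm))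
        (primrec_two_pow.to_comp.comp (Computable.snd.comp hx)))
      (Primrec.nat_add.to_comp.comp (Computable.snd.comp hx) hm)
  · rintro ⟨a, j, x⟩
    cases h : e j <;> simp [h]

/-- The value of `requestSum` as a rational number. -/
def requestSumRat (e : ℕ → Option (BinStr × ℕ)) (i : ℕ) : ℚ :=
  (requestSum e i).1 / 2 ^ (requestSum e i).2

theorem requestSumRat_succ_of_eq_some {e : ℕ → Option (BinStr × ℕ)} {i : ℕ} {r : BinStr × ℕ}
    (h : e i = some r) : requestSumRat e (i + 1) = requestSumRat e i + 1 / 2 ^ r.2 := by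
  simp only [requestSumRat, requestSum_succ, h, Option.elim]
  push_cast
  rw [pow_add]
  field_simp

theorem monotone_requestSumRat (e : ℕ → Option (BinStr × ℕ)) : Monotone (requestSumRat e) := by
  refine monotone_nat_of_le_succ fun i => ?_
  cases h : e i with
  | none => simp [requestSumRat, requestSum_succ, h]
  | some r =>
    rw [requestSumRat_succ_of_eq_some h]
    have : (0 : ℚ) ≤ 1 / 2 ^ r.2 := by positivity
    linarith

/-- Links the computable fraction to the analytic Kraft sum; the denominator is multiplied out to
avoid division in `ℝ≥0∞`. -/
theorem cast_requestSum (e : ℕ → Option (BinStr × ℕ)) (i : ℕ) :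
    ((requestSum e i).1 : ℝ≥0∞) =
      (∑ j ∈ Finset.range i, (e j).elim 0 fun r => (2 : ℝ≥0∞)⁻¹ ^ r.2) *
        2 ^ (requestSum e i).2 := by
  induction i with
  | zero => simp [requestSum]
  | succ i ih =>
    rw [Finset.sum_range_succ, requestSum_succ]
    cases h : e i with
    | none => simpa using ih
    | some r =>
      have h2 : (2 : ℝ≥0∞)⁻¹ ^ r.2 * 2 ^ r.2 = 1 := by
        rw [← mul_pow, ENNReal.inv_mul_cancel (by simp) (by simp), one_pow]
      simp only [Option.elim]
      push_cast
      rw [ih, pow_add, add_mul, ← mul_assoc, mul_left_comm _ (2 ^ (requestSum e i).2), h2, mul_one]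
      rfl

theorem requestSum_le {e : ℕ → Option (BinStr × ℕ)}
    (hsum : ∑' i, (e i).elim 0 (fun r => (2 : ℝ≥0∞)⁻¹ ^ r.2) ≤ 1) (i : ℕ) :
    (requestSum e i).1 ≤ 2 ^ (requestSum e i).2 := by
  have h : ((requestSum e i).1 : ℝ≥0∞) ≤ ((2 ^ (requestSum e i).2 : ℕ) : ℝ≥0∞) := by
    rw [cast_requestSum]
    push_cast
    calc _ ≤ (1 : ℝ≥0∞) * 2 ^ (requestSum e i).2 := by
          gcongr
          exact (ENNReal.sum_le_tsum _).trans hsum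
      _ = _ := one_mul _
  exact_mod_cast h

/-- The number of the code word of length `m + 1` that is allotted to the `i`-th request
`(s, m)`. -/
def codeNumber (e : ℕ → Option (BinStr × ℕ)) (i m : ℕ) : ℕ :=
  (requestSum e i).1 * 2 ^ (m + 1) / 2 ^ (requestSum e i).2 + 1

theorem codeNumber_lt {e : ℕ → Option (BinStr × ℕ)}
    (hsum : ∑' i, (e i).elim 0 (fun r => (2 : ℝ≥0∞)⁻¹ ^ r.2) ≤ 1) {i : ℕ} {r : BinStr × ℕ}
    (h : e i = some r) : codeNumber e i r.2 < 2 ^ (r.2 + 1) := by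
  have h1 := requestSum_le hsum (i + 1)
  rw [requestSum_succ, h] at h1
  simp only [Option.elim] at h1
  -- Serving the request adds `2⁻ᵐ` to the sum, hence 2 to its multiple by `2 ^ (m + 1)`, and the
  -- new sum is still at most 1.
  have h2 : (requestSum e i).1 * 2 ^ (r.2 + 1) / 2 ^ (requestSum e i).2 + 2 ≤ 2 ^ (r.2 + 1) := by
    rw [← Nat.add_mul_div_right _ _ (by positivity)]
    refine Nat.div_le_of_le_mul ?_
    calc _ = 2 * ((requestSum e i).1 * 2 ^ r.2 + 2 ^ (requestSum e i).2) := by ring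
      _ ≤ 2 * 2 ^ ((requestSum e i).2 + r.2) := by gcongr
      _ = _ := by ring
  unfold codeNumber
  omega

/-- The output of the decoder at stage `i` on the code word `q`. -/
def decodeStage (e : ℕ → Option (BinStr × ℕ)) (q : BinStr) (i : ℕ) : Option BinStr :=
  (e i).bind fun r =>
    bif (q.length == r.2 + 1) && (binValue q == codeNumber e i r.2) then some r.1 else none

theorem mem_decodeStage {e : ℕ → Option (BinStr × ℕ)} {q : BinStr} {i : ℕ} {s : BinStr} :
    s ∈ decodeStage e q i ↔ ∃ m, e i = some (s, m) ∧ q.length = m + 1 ∧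
      binValue q = codeNumber e i m := by
  unfold decodeStage
  rw [Option.mem_def, Option.bind_eq_some_iff]
  constructor
  · rintro ⟨⟨s', m⟩, h, hb⟩
    cases hc : ((q.length == m + 1) && (binValue q == codeNumber e i m)) with
    | false => simp [hc] at hb
    | true =>
      simp only [hc, cond_true, Option.some.injEq] at hb
      simp only [Bool.and_eq_true, beq_iff_eq] at hc
      subst hb
      exact ⟨m, h, hc⟩
  · rintro ⟨m, h, h1, h2⟩
    exact ⟨(s, m), h, by simp [h1, h2]⟩

theorem computable_decodeStage {e : ℕ → Option (BinStr × ℕ)} (he : Computable e) :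
    Computable₂ (decodeStage e) := by
  have hq : Computable fun y : (BinStr × ℕ) × (BinStr × ℕ) => y.1.1 :=
    Computable.fst.comp Computable.fst
  have hi : Computable fun y : (BinStr × ℕ) × (BinStr × ℕ) => requestSum e y.1.2 :=
    (computable_requestSum he).comp (Computable.snd.comp Computable.fst)
  have hm : Computable fun y : (BinStr × ℕ) × (BinStr × ℕ) => y.2.2 + 1 :=
    Computable.succ.comp (Computable.snd.comp Computable.snd)
  refine Computable.option_bind (he.comp Computable.snd) (Computable.cond ?_ ?_ ?_)
  · refine Primrec.and.to_comp.comp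
      (Primrec.beq.to_comp.comp (Computable.list_length.comp hq) hm)
      (Primrec.beq.to_comp.comp (primrec_binValue.to_comp.comp hq) ?_)
    exact Computable.succ.comp (Primrec.nat_div.to_comp.comp
      (Primrec.nat_mul.to_comp.comp (Computable.fst.comp hi) (primrec_two_pow.to_comp.comp hm))
      (primrec_two_pow.to_comp.comp (Computable.snd.comp hi)))
  · exact Computable.option_some.comp (Computable.fst.comp Computable.snd)
  · exact Computable.const none

/-- With the next lemma: if `S` is the sum so far, an interval of length `2⁻ᵐ` starting at `S`
contains the dyadic interval of length `2^{-(m+1)}` that begins at the first grid point beyond `S`.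
The extra bit in the code word pays for this rounding, so requests may arrive in any order. -/
theorem requestSumRat_lt_leftEnd {e : ℕ → Option (BinStr × ℕ)} {q s : BinStr} {i : ℕ}
    (h : s ∈ decodeStage e q i) : requestSumRat e i < leftEnd q := by
  obtain ⟨m, -, hl, hv⟩ := mem_decodeStage.1 h
  unfold requestSumRat leftEnd
  rw [hl, hv, div_lt_div_iff₀ (by positivity) (by positivity)]
  have := Nat.lt_mul_div_succ ((requestSum e i).1 * 2 ^ (m + 1))
    (b := 2 ^ (requestSum e i).2) (by positivity)
  rw [mul_comm (2 ^ _)] at this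
  exact_mod_cast this

theorem rightEnd_le_requestSumRat {e : ℕ → Option (BinStr × ℕ)} {q s : BinStr} {i : ℕ}
    (h : s ∈ decodeStage e q i) : rightEnd q ≤ requestSumRat e (i + 1) := by
  obtain ⟨m, he, hl, hv⟩ := mem_decodeStage.1 h
  rw [requestSumRat_succ_of_eq_some he]
  unfold requestSumRat rightEnd
  rw [hl, hv, div_add_div _ _ (by positivity) (by positivity),
    div_le_div_iff₀ (by positivity) (by positivity)]
  have h1 := Nat.div_mul_le_self ((requestSum e i).1 * 2 ^ (m + 1)) (2 ^ (requestSum e i).2)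
  have h2 : (codeNumber e i m + 1) * 2 ^ (requestSum e i).2 ≤
      ((requestSum e i).1 * 2 ^ m + 2 ^ (requestSum e i).2) * 2 := by
    unfold codeNumber
    rw [pow_succ] at h1 ⊢
    linarith
  have h3 := Nat.mul_le_mul_right (2 ^ m) h2
  have h4 : (codeNumber e i m + 1) * (2 ^ (requestSum e i).2 * 2 ^ m) ≤
      ((requestSum e i).1 * 2 ^ m + 2 ^ (requestSum e i).2 * 1) * 2 ^ (m + 1) := by
    rw [pow_succ 2 m]
    linarith
  exact_mod_cast h4

/-- A prefix relation nests the dyadic intervals, whereas those of different stages lie in disjoint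
segments between successive partial sums. -/
theorem stage_eq_of_prefix {e : ℕ → Option (BinStr × ℕ)} {p q s t : BinStr} {i j : ℕ}
    (hp : s ∈ decodeStage e p i) (hq : t ∈ decodeStage e q j) (h : p <+: q) : i = j := by
  have hl := leftEnd_le_of_prefix h
  have hr := rightEnd_le_of_prefix h
  have hlr := leftEnd_lt_rightEnd q
  rcases lt_trichotomy i j with hij | hij | hij
  · have := monotone_requestSumRat e hij
    linarith [rightEnd_le_requestSumRat hp, requestSumRat_lt_leftEnd hq]
  · exact hij
  · have := monotone_requestSumRat e hij
    linarith [rightEnd_le_requestSumRat hq, requestSumRat_lt_leftEnd hp]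

/-- A form of the Kraft–Chaitin theorem: a computable list of requests `(s, m)` with
`∑ 2⁻ᵐ ≤ 1` is served by a computer that has a program of length `m + 1` for `s`. -/
theorem exists_isComputer_of_requests {e : ℕ → Option (BinStr × ℕ)} (he : Computable e)
    (hsum : ∑' i, (e i).elim 0 (fun r => (2 : ℝ≥0∞)⁻¹ ^ r.2) ≤ 1) :
    ∃ C : BinStr →. BinStr, IsComputer C ∧
      ∀ i s m, e i = some (s, m) → ∃ q : BinStr, s ∈ C q ∧ q.length = m + 1 := by
  refine ⟨fun q => Nat.rfindOpt (decodeStage e q), ⟨Partrec.rfindOpt (computable_decodeStage he),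
    ?_⟩, ?_⟩
  · intro p hp q hq h
    obtain ⟨i, s, hi⟩ := Nat.rfindOpt_dom.1 hp
    obtain ⟨j, t, hj⟩ := Nat.rfindOpt_dom.1 hq
    obtain rfl := stage_eq_of_prefix hi hj h
    obtain ⟨m, he₁, hl₁, -⟩ := mem_decodeStage.1 hi
    obtain ⟨n, he₂, hl₂, -⟩ := mem_decodeStage.1 hj
    have : m = n := by
      rw [he₁] at he₂
      simp at he₂
      exact he₂.2
    exact h.eq_of_length (by omega)
  · intro i s m h
    obtain ⟨q, hl, hv⟩ := exists_binValue_eq (codeNumber_lt hsum h)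
    have hmem : s ∈ decodeStage e q i := mem_decodeStage.2 ⟨m, h, hl, hv⟩
    refine ⟨q, ?_, hl⟩
    have hd : (Nat.rfindOpt (decodeStage e q)).Dom := Nat.rfindOpt_dom.2 ⟨i, s, hmem⟩
    obtain ⟨t, ht⟩ := Part.dom_iff_mem.1 hd
    -- The search might stop at another stage `j`, but a code word belongs to only one stage.
    obtain ⟨j, hj⟩ := Nat.rfindOpt_spec ht
    obtain rfl := stage_eq_of_prefix hmem hj List.prefix_rfl
    rwa [Option.mem_unique hmem hj]

/-! ### Computable enumerations and approximations -/

/-- Every partial recursive function is the limit of a computable sequence of finite stages. -/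
theorem exists_stages {α σ : Type*} [Primcodable α] [Primcodable σ] {F : α →. σ}
    (hF : Partrec F) : ∃ φ : ℕ → α → Option σ, Computable₂ φ ∧
      ∀ a b, b ∈ F a ↔ ∃ k, b ∈ φ k a := by
  obtain ⟨c, hc⟩ := Nat.Partrec.Code.exists_code.1 hF
  have hmem : ∀ a n, n ∈ c.eval (Encodable.encode a) ↔ ∃ b ∈ F a, Encodable.encode b = n := by
    intro a n
    rw [hc]
    simp [Part.mem_map_iff]
  refine ⟨fun k a => (c.evaln k (Encodable.encode a)).bind Encodable.decode, ?_, fun a b => ?_⟩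
  · exact Computable.option_bind
      (Nat.Partrec.Code.primrec_evaln.to_comp.comp
        (Computable.pair (Computable.pair Computable.fst (Computable.const c))
          (Computable.encode.comp Computable.snd)))
      (Computable.decode.comp Computable.snd)
  · constructor
    · intro hb
      obtain ⟨k, hk⟩ := Nat.Partrec.Code.evaln_complete.1 ((hmem a _).2 ⟨b, hb, rfl⟩)
      exact ⟨k, Option.bind_eq_some_iff.2 ⟨_, hk, Encodable.encodek b⟩⟩
    · rintro ⟨k, hk⟩
      obtain ⟨n, hn, hb⟩ := Option.bind_eq_some_iff.1 hk
      obtain ⟨b', hb', rfl⟩ := (hmem a n).1 (Nat.Partrec.Code.evaln_sound hn)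
      rw [Encodable.encodek, Option.some.injEq] at hb
      exact hb ▸ hb'

/-- The first `i` values of a sequence, in reverse order. -/
def prefixList {α : Type*} (e : ℕ → α) (i : ℕ) : List α :=
  Nat.rec [] (fun j l => e j :: l) i

theorem mem_prefixList {α : Type*} {e : ℕ → α} {i : ℕ} {a : α} :
    a ∈ prefixList e i ↔ ∃ j < i, e j = a := by
  induction i with
  | zero => simp [prefixList]
  | succ i ih =>
    rw [show prefixList e (i + 1) = e i :: prefixList e i from rfl, List.mem_cons, ih]
    constructor
    · rintro (rfl | ⟨j, hj, rfl⟩)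
      · exact ⟨i, by omega, rfl⟩
      · exact ⟨j, by omega, rfl⟩
    · rintro ⟨j, hj, rfl⟩
      rcases Nat.lt_succ_iff_lt_or_eq.1 hj with h | rfl
      · exact Or.inr ⟨j, h, rfl⟩
      · exact Or.inl rfl

/-- Repetitions can be removed from a computable enumeration. -/
theorem exists_enum_injective {α : Type*} [Primcodable α] {e : ℕ → Option α}
    (he : Computable e) : ∃ e' : ℕ → Option α, Computable e' ∧
      (∀ a, (∃ i, e' i = some a) ↔ ∃ i, e i = some a) ∧
      ∀ i j a, e' i = some a → e' j = some a → i = j := by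
  classical
  let _ : BEq (Option α) := instBEqOfDecidableEq
  -- `idxOf` equals the length exactly when the entry is absent, so this comparison is a computable
  -- test for an earlier occurrence.
  have hiff : ∀ i a, (bif decide ((prefixList e i).idxOf (e i) < (prefixList e i).length)
      then none else e i) = some a ↔ e i = some a ∧ ∀ j < i, e j ≠ some a := by
    intro i a
    rw [Bool.cond_decide]
    split_ifs with h
    · simp only [false_iff, not_and, not_forall, not_not]
      intro ha
      obtain ⟨j, hj, h⟩ := mem_prefixList.1 (List.idxOf_lt_length_iff.1 h)
      exact ⟨j, hj, h.trans ha⟩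
    · refine ⟨fun ha => ⟨ha, fun j hj hja => h ?_⟩, fun ha => ha.1⟩
      exact List.idxOf_lt_length_iff.2 (mem_prefixList.2 ⟨j, hj, hja.trans ha.symm⟩)
  refine ⟨fun i => bif decide ((prefixList e i).idxOf (e i) < (prefixList e i).length)
      then none else e i, ?_, fun a => ?_, fun i j a hi hj => ?_⟩
  · have hl : Computable (prefixList e) :=
      Computable.nat_rec Computable.id (Computable.const [])
        (h := fun _ y => e y.1 :: y.2)
        (Computable.list_cons.comp (he.comp (Computable.fst.comp Computable.snd))
          (Computable.snd.comp Computable.snd))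
    exact Computable.cond (Primrec.nat_lt.decide.to_comp.comp
      (Primrec.list_idxOf.to_comp.comp he hl) (Computable.list_length.comp hl))
      (Computable.const none) he
  · simp only [hiff]
    refine ⟨fun ⟨i, hi⟩ => ⟨i, hi.1⟩, fun h => ⟨Nat.find h, Nat.find_spec h, fun j hj =>
      Nat.find_min h hj⟩⟩
  · rw [hiff] at hi hj
    rcases lt_trichotomy i j with h | h | h
    · exact absurd hi.1 (hj.2 i h)
    · exact h
    · exact absurd hj.1 (hi.2 j h)

theorem computable_toNat : Computable Int.toNat := by
  refine Primrec.to_comp (((Primrec.ite (Primrec.eq.comp (Primrec.nat_mod.comp Primrec.encode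
    (Primrec.const 2)) (Primrec.const 0)) (Primrec.nat_div.comp Primrec.encode
    (Primrec.const 2)) (Primrec.const 0))).of_eq fun z => ?_)
  rcases z with n | n
  · have h : Encodable.encode (Int.ofNat n) = 2 * n := rfl
    rw [h]
    simp
  · have h : Encodable.encode (Int.negSucc n) = 2 * n + 1 := rfl
    rw [h]
    simp [Int.toNat, Nat.add_mod]

theorem computable_succPNat : Computable Nat.succPNat :=
  Computable.encode_iff.1 (Computable.id.of_eq fun _ => rfl)

/-- For a lower-computable `f`, the relation `2 ^ n < f l` is recursively enumerable. -/
theorem LowerComputable.exists_test {f : ℕ+ → ℝ≥0} (hf : LowerComputable f) :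
    ∃ T : ℕ+ × ℕ → ℕ → Bool, Computable₂ T ∧
      ∀ l n, 2 ^ n < f l ↔ ∃ k, T (l, n) k = true := by
  obtain ⟨a, ⟨num, den, hnum, hden, ha⟩, hlim⟩ := hf
  refine ⟨fun x k => decide (2 ^ x.2 * den (Nat.succPNat k, x.1) <
    (num (Nat.succPNat k, x.1)).toNat), ?_, fun l n => ?_⟩
  · have hx : Computable fun y : (ℕ+ × ℕ) × ℕ => (Nat.succPNat y.2, y.1.1) :=
      Computable.pair (computable_succPNat.comp Computable.snd)
        (Computable.fst.comp Computable.fst)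
    exact Primrec.nat_lt.decide.to_comp.comp
      (Primrec.nat_mul.to_comp.comp
        (primrec_two_pow.to_comp.comp (Computable.snd.comp Computable.fst)) (hden.comp hx))
      (computable_toNat.comp (hnum.comp hx))
  -- Truncating a negative numerator to 0 is harmless, as the other side is nonnegative and the
  -- inequality strict.
  · have hT : ∀ k : ℕ+, 2 ^ n * den (k, l) < (num (k, l)).toNat ↔ (2 : ℝ) ^ n < a (k, l) := by
      intro k
      obtain ⟨hpos, heq⟩ := ha (k, l)
      rw [Int.lt_toNat, heq]
      push_cast
      rw [lt_div_iff₀ (by exact_mod_cast hpos)]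
      exact_mod_cast Iff.rfl
    simp only [decide_eq_true_eq, hT]
    obtain ⟨ht, hle⟩ := hlim l
    constructor
    · intro h
      obtain ⟨k, hk⟩ := (ht.eventually_const_lt (u := (2 : ℝ) ^ n) (by exact_mod_cast h)).exists
      exact ⟨k.natPred, by rwa [PNat.succPNat_natPred]⟩
    · rintro ⟨k, hk⟩
      exact_mod_cast hk.trans_le (hle _)

/-! ### Complexity and the list of requests -/

theorem IsOptimal.exists_program_of_complexity {U : BinStr →. BinStr} (hU : IsOptimal U)
    (s : BinStr) : ∃ p : BinStr, s ∈ U p ∧ p.length = complexity U s := by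
  obtain ⟨p, hp⟩ := hU.exists_program s
  exact Nat.sInf_mem (s := {l : ℕ | ∃ p : BinStr, s ∈ U p ∧ p.length = l}) ⟨_, p, hp, rfl⟩

theorem complexity_le {U : BinStr →. BinStr} {p s : BinStr} (h : s ∈ U p) :
    complexity U s ≤ p.length := Nat.sInf_le ⟨p, h, rfl⟩

/-- Shortest programs of distinct strings are distinct, and there are finitely many short programs.
-/
theorem IsOptimal.finite_complexity_lt {U : BinStr →. BinStr} (hU : IsOptimal U) (L : ℕ) :
    {s : BinStr | complexity U s < L}.Finite := by
  choose g hg hl using hU.exists_program_of_complexity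
  refine Set.Finite.of_finite_image ((List.finite_length_lt Bool L).subset ?_)
    (f := g) fun s _ t _ hst => ?_
  · rintro _ ⟨s, hs, rfl⟩
    exact (hl s).trans_lt hs
  · exact Part.mem_unique (hg s) (hst ▸ hg t)

/-- The requests `(s, m)` with `m = |p| + d - n` for a program `p` of `s ∈ A` of length at least
`l₀` with `2 ^ n < f (|p|)`. -/
def IsRequest (U : BinStr →. BinStr) (A : Set BinStr) (f : ℕ+ → ℝ≥0) (l₀ : ℕ+) (d : ℕ)
    (r : BinStr × ℕ) : Prop :=
  r.1 ∈ A ∧ ∃ (p : BinStr) (l : ℕ+) (n : ℕ), r.1 ∈ U p ∧ (l : ℕ) = p.length ∧ l₀ ≤ l ∧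
    2 ^ n < f l ∧ r.2 + n = p.length + d

/-- Dovetailing: one code carries `p`, `m`, `n` together with stages that witness `s ∈ U p`, `s ∈ A`
and `2 ^ n < f(|p|)`. -/
theorem exists_enum_isRequest {U : BinStr →. BinStr} (hU : IsOptimal U)
    {A : Set BinStr} (hA : REPred fun s : BinStr => s ∈ A) {f : ℕ+ → ℝ≥0}
    (hf : LowerComputable f) (l₀ : ℕ+) (d : ℕ) :
    ∃ e : ℕ → Option (BinStr × ℕ), Computable e ∧
      ∀ r, (∃ i, e i = some r) ↔ IsRequest U A f l₀ d r := by
  obtain ⟨φ, hφ, hφU⟩ := exists_stages hU.isComputer.partrec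
  obtain ⟨ψ, hψ, hψA⟩ := exists_stages hA
  obtain ⟨T, hT, hTf⟩ := hf.exists_test
  have hA' : ∀ s, s ∈ A ↔ ∃ k, () ∈ ψ k s := fun s => by
    rw [← hψA]
    simp
  -- The value 1 at the empty string is never used, since the empty string is not a program.
  let len : BinStr → ℕ+ := fun p => Nat.succPNat (p.length - 1)
  let step : (BinStr × ℕ × ℕ) × ℕ × ℕ × ℕ → Option (BinStr × ℕ) := fun x =>
    bif (T (len x.1.1, x.1.2.2) x.2.2.2 && decide ((l₀ : ℕ) ≤ x.1.1.length)) &&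
      decide (x.1.2.1 + x.1.2.2 = x.1.1.length + d) then
      (φ x.2.1 x.1.1).bind fun s => (ψ x.2.2.1 s).map fun _ => (s, x.1.2.1)
    else none
  have hstep : Computable step := by
    have hp : Computable fun x : (BinStr × ℕ × ℕ) × ℕ × ℕ × ℕ => x.1.1 :=
      Computable.fst.comp Computable.fst
    have hl := Computable.list_length.comp hp
    have hm : Computable fun x : (BinStr × ℕ × ℕ) × ℕ × ℕ × ℕ => x.1.2.1 :=
      Computable.fst.comp (Computable.snd.comp Computable.fst)
    have hn : Computable fun x : (BinStr × ℕ × ℕ) × ℕ × ℕ × ℕ => x.1.2.2 :=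
      Computable.snd.comp (Computable.snd.comp Computable.fst)
    have hj : Computable fun x : (BinStr × ℕ × ℕ) × ℕ × ℕ × ℕ => x.2.1 :=
      Computable.fst.comp Computable.snd
    have hj' : Computable fun x : (BinStr × ℕ × ℕ) × ℕ × ℕ × ℕ => x.2.2.1 :=
      Computable.fst.comp (Computable.snd.comp Computable.snd)
    have hk : Computable fun x : (BinStr × ℕ × ℕ) × ℕ × ℕ × ℕ => x.2.2.2 :=
      Computable.snd.comp (Computable.snd.comp Computable.snd)
    refine Computable.cond ?_ ?_ (Computable.const none)
    · refine Primrec.and.to_comp.comp (Primrec.and.to_comp.comp (hT.comp (Computable.pair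
        (computable_succPNat.comp (Primrec.nat_sub.to_comp.comp hl (Computable.const 1))) hn) hk)
        (Primrec.nat_le.decide.to_comp.comp (Computable.const _) hl)) ?_
      exact Primrec.eq.decide.to_comp.comp (Primrec.nat_add.to_comp.comp hm hn)
        (Primrec.nat_add.to_comp.comp hl (Computable.const d))
    · refine Computable.option_bind (hφ.comp hj hp) (Computable.option_map
        (hψ.comp (hj'.comp Computable.fst) Computable.snd) ?_)
      exact Computable.pair (Computable.snd.comp Computable.fst)
        (hm.comp (Computable.fst.comp Computable.fst))
  have hmem : ∀ x r, step x = some r ↔ (T (len x.1.1, x.1.2.2) x.2.2.2 = true ∧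
      (l₀ : ℕ) ≤ x.1.1.length ∧ x.1.2.1 + x.1.2.2 = x.1.1.length + d) ∧
      r.1 ∈ φ x.2.1 x.1.1 ∧ () ∈ ψ x.2.2.1 r.1 ∧ r.2 = x.1.2.1 := by
    rintro x ⟨s, m⟩
    simp only [step, Bool.cond_eq_ite, Bool.and_eq_true, decide_eq_true_eq, and_assoc,
      Option.ite_none_right_eq_some, Option.bind_eq_some_iff, Option.map_eq_some_iff,
      Prod.mk.injEq, Option.mem_def]
    refine and_congr_right fun _ => and_congr_right fun _ => and_congr_right fun _ => ?_
    constructor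
    · rintro ⟨s, h, ⟨⟩, h', rfl, rfl⟩
      exact ⟨h, h', rfl⟩
    · rintro ⟨h, h', rfl⟩
      exact ⟨s, h, (), h', rfl, rfl⟩
  have hlen : ∀ (p s : BinStr) (l : ℕ+), s ∈ U p → (l : ℕ) = p.length → len p = l := by
    intro p s l h hl
    apply PNat.coe_injective
    have := hU.length_pos h
    simp only [len, Nat.succPNat_coe]
    omega
  refine ⟨fun i => (Encodable.decode i).bind step, Computable.option_bind Computable.decode
    (hstep.comp Computable.snd), fun r => ?_⟩
  constructor
  · rintro ⟨i, hi⟩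
    obtain ⟨x, -, hx⟩ := Option.bind_eq_some_iff.1 hi
    obtain ⟨⟨h1, h2, h3⟩, h4, h5, h6⟩ := (hmem x r).1 hx
    have hp : r.1 ∈ U x.1.1 := (hφU _ _).2 ⟨_, h4⟩
    have hl : ((⟨x.1.1.length, hU.length_pos hp⟩ : ℕ+) : ℕ) = x.1.1.length := rfl
    rw [hlen _ _ _ hp hl] at h1
    exact ⟨(hA' _).2 ⟨_, h5⟩, x.1.1, _, x.1.2.2, hp, hl, h2, (hTf _ _).2 ⟨_, h1⟩, h6 ▸ h3⟩
  · rintro ⟨hs, p, l, n, hp, hl, hl₀, hn, hm⟩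
    obtain ⟨j, hj⟩ := (hφU _ _).1 hp
    obtain ⟨j', hj'⟩ := (hA' _).1 hs
    obtain ⟨k, hk⟩ := (hTf _ _).1 hn
    refine ⟨Encodable.encode (((p, r.2, n), j, j', k) : (BinStr × ℕ × ℕ) × ℕ × ℕ × ℕ), ?_⟩
    simp only [Encodable.encodek, Option.bind_some]
    refine (hmem _ r).2 ⟨⟨?_, ?_, hm⟩, hj, hj', rfl⟩
    · rw [hlen p _ l hp hl]
      exact hk
    · rw [← hl]
      exact hl₀

/-! ### The total weight of the requests -/

theorem tsum_enum_le {α : Type*} {e : ℕ → Option α}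
    (hinj : ∀ i j a, e i = some a → e j = some a → i = j) (w : α → ℝ≥0∞) (W : Set α)
    (hW : ∀ i a, e i = some a → a ∈ W) :
    ∑' i, (e i).elim 0 w ≤ ∑' a : W, w a := by
  let S : Set ℕ := {i | (e i).isSome}
  have hsupp : Function.support (fun i => (e i).elim 0 w) ⊆ S := by
    intro i hi
    cases h : e i with
    | none => simp [h] at hi
    | some a => simp [S, h]
  rw [← tsum_subtype_eq_of_support_subset hsupp]
  let g : S → W := fun i => ⟨(e i).get i.2, hW i _ (Option.some_get i.2).symm⟩
  have hg : Function.Injective g := by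
    intro i j hij
    have h : (e i).get i.2 = (e j).get j.2 := congrArg Subtype.val hij
    exact Subtype.ext (hinj i j _ (Option.some_get i.2).symm (h ▸ (Option.some_get j.2).symm))
  calc ∑' i : S, (e i).elim 0 w = ∑' i : S, w (g i) := by
        refine tsum_congr fun i => ?_
        conv_lhs => rw [← Option.some_get i.2]
        rfl
    _ ≤ _ := ENNReal.tsum_comp_le_tsum_of_injective hg (fun a : W => w a)

/-- Distinct exponents starting at the minimum of `M` are dominated by a full geometric series,
which costs the factor 2. -/
theorem tsum_inv_two_pow_le {M : Set ℕ} {c : ℝ≥0∞} (h : ∀ m ∈ M, (2 : ℝ≥0∞)⁻¹ ^ m ≤ c) :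
    ∑' m : M, (2 : ℝ≥0∞)⁻¹ ^ (m : ℕ) ≤ 2 * c := by
  rcases M.eq_empty_or_nonempty with rfl | hM
  · simp
  have hmin := Nat.sInf_mem hM
  let g : M → ℕ := fun m => m - sInf M
  have hle : ∀ m : M, sInf M ≤ m := fun m => Nat.sInf_le m.2
  have hg : Function.Injective g := by
    intro m n hmn
    have := hle m
    have := hle n
    simp only [g] at hmn
    exact Subtype.ext (by omega)
  calc ∑' m : M, (2 : ℝ≥0∞)⁻¹ ^ (m : ℕ) = ∑' m : M, (2 : ℝ≥0∞)⁻¹ ^ sInf M * 2⁻¹ ^ g m := by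
        refine tsum_congr fun m => ?_
        rw [← pow_add, Nat.add_sub_cancel' (hle m)]
    _ = (2 : ℝ≥0∞)⁻¹ ^ sInf M * ∑' m : M, (2 : ℝ≥0∞)⁻¹ ^ g m := ENNReal.tsum_mul_left
    _ ≤ c * ∑' n : ℕ, (2 : ℝ≥0∞)⁻¹ ^ n := mul_le_mul' (h _ hmin)
        (ENNReal.tsum_comp_le_tsum_of_injective hg fun n => (2 : ℝ≥0∞)⁻¹ ^ n)
    _ = 2 * c := by
        rw [ENNReal.tsum_geometric, ENNReal.one_sub_inv_two, inv_inv, mul_comm]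

theorem two_pow_mul_inv_two_pow (n : ℕ) : (2 : ℝ≥0∞) ^ n * 2⁻¹ ^ n = 1 := by
  rw [← mul_pow, ENNReal.mul_inv_cancel (by simp) (by simp), one_pow]

theorem IsRequest.inv_two_pow_le {U : BinStr →. BinStr} {A : Set BinStr} {f : ℕ+ → ℝ≥0} {l₀ : ℕ+}
    {g : BinStr → ℝ≥0∞} (hg : ∀ s ∈ A, ∀ (p : BinStr) (l : ℕ+), s ∈ U p → (l : ℕ) = p.length →
      l₀ ≤ l → (f l : ℝ≥0∞) * (2 : ℝ≥0∞)⁻¹ ^ (l : ℕ) ≤ g s) {d : ℕ} {r : BinStr × ℕ}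
    (hr : IsRequest U A f l₀ d r) : (2 : ℝ≥0∞)⁻¹ ^ r.2 ≤ g r.1 * 2⁻¹ ^ d := by
  obtain ⟨hs, p, l, n, hp, hl, hl₀, hn, hm⟩ := hr
  have hn' : (2 : ℝ≥0∞) ^ n ≤ f l := by exact_mod_cast hn.le
  calc (2 : ℝ≥0∞)⁻¹ ^ r.2 = 2 ^ n * 2⁻¹ ^ n * 2⁻¹ ^ r.2 := by
        rw [two_pow_mul_inv_two_pow, one_mul]
    _ = 2 ^ n * 2⁻¹ ^ (l : ℕ) * 2⁻¹ ^ d := by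
        rw [mul_assoc, mul_assoc, ← pow_add, ← pow_add, hl, ← hm, add_comm]
    _ ≤ f l * 2⁻¹ ^ (l : ℕ) * 2⁻¹ ^ d := by gcongr
    _ ≤ g r.1 * 2⁻¹ ^ d := by
        gcongr
        exact hg _ hs p l hp hl hl₀

/-- Grouping by `s` and counting each length once matters: `s` may have many programs, but equal
requests coincide. -/
theorem tsum_isRequest_le {U : BinStr →. BinStr} {A : Set BinStr} {f : ℕ+ → ℝ≥0} {l₀ : ℕ+}
    {g : BinStr → ℝ≥0∞} (hg : ∀ s ∈ A, ∀ (p : BinStr) (l : ℕ+), s ∈ U p → (l : ℕ) = p.length →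
      l₀ ≤ l → (f l : ℝ≥0∞) * (2 : ℝ≥0∞)⁻¹ ^ (l : ℕ) ≤ g s) (d : ℕ) :
    ∑' r : {r | IsRequest U A f l₀ d r}, (2 : ℝ≥0∞)⁻¹ ^ r.1.2 ≤
      2 * (∑' s : A, g s) * 2⁻¹ ^ d := by
  let ι : {r | IsRequest U A f l₀ d r} → Σ s : A, {m | IsRequest U A f l₀ d (s, m)} :=
    fun r => ⟨⟨r.1.1, r.2.1⟩, ⟨r.1.2, r.2⟩⟩
  let π : (Σ s : A, {m | IsRequest U A f l₀ d (s, m)}) → BinStr × ℕ := fun x => (x.1, x.2)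
  have hι : Function.Injective ι := by
    intro r t h
    exact Subtype.ext (congrArg π h)
  calc ∑' r : {r | IsRequest U A f l₀ d r}, (2 : ℝ≥0∞)⁻¹ ^ r.1.2
      ≤ ∑' x : Σ s : A, {m | IsRequest U A f l₀ d (s, m)}, (2 : ℝ≥0∞)⁻¹ ^ (x.2 : ℕ) :=
        ENNReal.tsum_comp_le_tsum_of_injective hι
          fun x : Σ s : A, {m | IsRequest U A f l₀ d (s, m)} => (2 : ℝ≥0∞)⁻¹ ^ (x.2 : ℕ)
    _ = ∑' (s : A) (m : {m | IsRequest U A f l₀ d (s, m)}), (2 : ℝ≥0∞)⁻¹ ^ (m : ℕ) :=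
        ENNReal.tsum_sigma' _
    _ ≤ ∑' s : A, 2 * (g s * 2⁻¹ ^ d) := ENNReal.tsum_le_tsum fun s =>
        tsum_inv_two_pow_le fun m hm => IsRequest.inv_two_pow_le hg hm
    _ = _ := by rw [ENNReal.tsum_mul_left, ENNReal.tsum_mul_right, mul_assoc]

/-! ### The divergence criterion -/

/-- A function on an infinite recursively enumerable set `A` that dominates `f(|p|) 2^{-|p|}` for
all long programs `p` of the elements of `A` has an infinite sum. -/
theorem tsum_eq_top_of_le {U : BinStr →. BinStr} (hU : IsOptimal U) {A : Set BinStr}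
    (hAinf : A.Infinite) (hAre : REPred fun s : BinStr => s ∈ A) {f : ℕ+ → ℝ≥0}
    (hf : LowerComputable f) (hlim : Tendsto f atTop atTop) (l₀ : ℕ+) {g : BinStr → ℝ≥0∞}
    (hg : ∀ s ∈ A, ∀ (p : BinStr) (l : ℕ+), s ∈ U p → (l : ℕ) = p.length →
      l₀ ≤ l → (f l : ℝ≥0∞) * (2 : ℝ≥0∞)⁻¹ ^ (l : ℕ) ≤ g s) :
    ∑' s : A, g s = ∞ := by
  by_contra hne
  obtain ⟨d, hd⟩ : ∃ d : ℕ, 2 * (∑' s : A, g s) ≤ 2 ^ d := by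
    obtain ⟨d, hd⟩ := ENNReal.exists_nat_gt (ENNReal.mul_ne_top (by simp : (2 : ℝ≥0∞) ≠ ∞) hne)
    refine ⟨d, hd.le.trans ?_⟩
    exact_mod_cast d.lt_two_pow_self.le
  obtain ⟨e₀, he₀, hW₀⟩ := exists_enum_isRequest hU hAre hf l₀ d
  obtain ⟨e, he, hW, hinj⟩ := exists_enum_injective he₀
  simp only [hW₀] at hW
  obtain ⟨C, hC, hCW⟩ := exists_isComputer_of_requests he <|
    calc ∑' i, (e i).elim 0 (fun r => (2 : ℝ≥0∞)⁻¹ ^ r.2)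
        ≤ ∑' r : {r | IsRequest U A f l₀ d r}, (2 : ℝ≥0∞)⁻¹ ^ r.1.2 :=
          tsum_enum_le hinj (fun r => (2 : ℝ≥0∞)⁻¹ ^ r.2) _ fun i r h => (hW r).1 ⟨i, h⟩
      _ ≤ 2 * (∑' s : A, g s) * 2⁻¹ ^ d := tsum_isRequest_le hg d
      _ ≤ 2 ^ d * 2⁻¹ ^ d := by gcongr
      _ = 1 := two_pow_mul_inv_two_pow d
  obtain ⟨sim, hsim⟩ := hU.simulates C hC
  -- In the exponent, `d` cancels the shift in the requests, `sim` the simulation cost, one unit the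
  -- extra bit of the code word, and the last unit makes the final inequality strict.
  obtain ⟨L, hL⟩ := eventually_atTop.1 (hlim.eventually_gt_atTop (2 ^ (d + sim + 2)))
  obtain ⟨s, hsA, hs⟩ := hAinf.exists_notMem_finite (hU.finite_complexity_lt (max L l₀ : ℕ+))
  have hH : max L l₀ ≤ hU.H s := by
    rw [Set.mem_ofPred_eq, not_lt] at hs
    exact hs
  obtain ⟨p, hp, hpl⟩ := hU.exists_program_of_complexity s
  have hlen : (hU.H s : ℕ) = p.length := hpl.symm
  have hbig : 2 ^ (d + sim + 2) < f (hU.H s) := hL _ ((le_max_left _ _).trans hH)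
  have hl₀ : l₀ ≤ hU.H s := (le_max_right _ _).trans hH
  rcases le_total (d + sim + 2) (p.length + d) with hle | hle
  · obtain ⟨i, hi⟩ := (hW (s, p.length + d - (d + sim + 2))).2
      ⟨hsA, p, hU.H s, d + sim + 2, hp, hlen, hl₀, hbig, Nat.sub_add_cancel hle⟩
    obtain ⟨q, hq, hql⟩ := hCW i _ _ hi
    obtain ⟨p', hp', hpl'⟩ := hsim q s hq
    have := complexity_le hp'
    omega
  -- Here the requested length could be negative, so no request need exist; but then this single
  -- term `g s` already exceeds `2 ^ d`.
  · have h1 : (2 : ℝ≥0∞) ^ d < 2 ^ d := by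
      calc (2 : ℝ≥0∞) ^ d = 2 ^ d * (2 ^ p.length * 2⁻¹ ^ p.length) := by
            rw [two_pow_mul_inv_two_pow, mul_one]
        _ = 2 ^ (p.length + d) * 2⁻¹ ^ p.length := by ring
        _ ≤ 2 ^ (d + sim + 2) * 2⁻¹ ^ p.length := by
            gcongr
            · exact one_le_two
        _ < f (hU.H s) * 2⁻¹ ^ p.length := by
            refine ENNReal.mul_lt_mul_left ?_ ?_ ?_
            · simp
            · simp
            · exact_mod_cast hbig
        _ ≤ g s := hlen ▸ hg s hsA p _ hp hlen hl₀
        _ ≤ ∑' s : A, g s := ENNReal.le_tsum (f := fun s : A => g s) ⟨s, hsA⟩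
        _ ≤ 2 * ∑' s : A, g s := le_mul_of_one_le_left' one_le_two
        _ ≤ 2 ^ d := hd
    exact h1.false

end AIT

/-! ### The two divergent sums -/

open AIT in
theorem theorem3p2 (U : AIT.BinStr →. AIT.BinStr) (hU : AIT.IsOptimal U)
    (A : Set AIT.BinStr) (hAinf : A.Infinite) (hAre : REPred (fun s : AIT.BinStr => s ∈ A))
    (f : ℕ+ → ℝ≥0) (hf : AIT.LowerComputable f) (hlim : Tendsto f atTop atTop) :
    (∑' p : {p : AIT.BinStr // ∃ s ∈ A, s ∈ U p},
        (f (hU.progLength p) : ℝ≥0∞) * (2 : ℝ≥0∞)⁻¹ ^ p.1.length = ∞) ∧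
    ((∃ l₀ : ℕ+, AntitoneOn (fun l : ℕ+ => f l * (2 : ℝ≥0)⁻¹ ^ (l : ℕ)) (Set.Ici l₀)) →
      ∑' s : A, (f (hU.H s.1) : ℝ≥0∞) * (2 : ℝ≥0∞)⁻¹ ^ (hU.H s.1 : ℕ) = ∞) := by
  constructor
  · let F : {p : BinStr // ∃ s ∈ A, s ∈ U p} → ℝ≥0∞ :=
      fun p => (f (hU.progLength p) : ℝ≥0∞) * (2 : ℝ≥0∞)⁻¹ ^ p.1.length
    let P : BinStr → Set {p : BinStr // ∃ s ∈ A, s ∈ U p} := fun s => {p | s ∈ U p.1}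
    have htop : ∑' s : A, ∑' p : P s, F p = ∞ := by
      refine tsum_eq_top_of_le hU hAinf hAre hf hlim 1 (g := fun s => ∑' p : P s, F p)
        fun s hs p l hp hl _ => ?_
      let p' : P s := ⟨⟨p, s, hs, hp⟩, hp⟩
      have hp' : hU.progLength p'.1 = l := PNat.coe_injective hl.symm
      calc (f l : ℝ≥0∞) * (2 : ℝ≥0∞)⁻¹ ^ (l : ℕ) = F p' := by
            simp only [F, hp', hl, p']
        _ ≤ ∑' p : P s, F p := ENNReal.le_tsum (f := fun p : P s => F p) p'
    -- Each program has a single output, so grouping programs by output counts none twice.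
    have hinj : Function.Injective fun x : Σ s : A, P s => x.2.1 := by
      rintro ⟨⟨s, hs⟩, ⟨p, hp⟩⟩ ⟨⟨t, ht⟩, ⟨q, hq⟩⟩ rfl
      obtain rfl : s = t := Part.mem_unique hp hq
      rfl
    refine top_unique ?_
    calc ∞ = ∑' s : A, ∑' p : P s, F p := htop.symm
      _ = ∑' x : Σ s : A, P s, F x.2 := (ENNReal.tsum_sigma' fun x : Σ s : A, P s => F x.2).symm
      _ ≤ ∑' p, F p := ENNReal.tsum_comp_le_tsum_of_injective hinj F
  · rintro ⟨l₀, hanti⟩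
    let G : ℕ+ → ℝ≥0∞ := fun l => (f l : ℝ≥0∞) * (2 : ℝ≥0∞)⁻¹ ^ (l : ℕ)
    have hG : ∀ {k l : ℕ+}, l₀ ≤ k → k ≤ l → G l ≤ G k := by
      intro k l hk hkl
      have h := hanti (Set.mem_Ici.2 hk) (Set.mem_Ici.2 (hk.trans hkl)) hkl
      have h' := ENNReal.coe_le_coe.2 h
      simpa only [G, ENNReal.coe_mul, ENNReal.coe_pow, ENNReal.coe_inv_two] using h'
    let D : Set BinStr := {s | complexity U s < l₀}
    have hD : D.Finite := hU.finite_complexity_lt l₀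
    -- For `H(s) < l₀` the term at `H(s)` need not dominate; the value at `l₀` bounds all terms with
    -- `l ≥ l₀` instead, and finitely many such corrections have a finite sum.
    let E : BinStr → ℝ≥0∞ := D.indicator fun _ => G l₀
    have htop : ∑' s : A, (G (hU.H s) + E s) = ∞ := by
      refine tsum_eq_top_of_le hU hAinf hAre hf hlim l₀ (g := fun s => G (hU.H s) + E s)
        fun s hs p l hp hl hl₀ => ?_
      by_cases h : s ∈ D
      · refine le_add_left ?_
        rw [show E s = G l₀ from Set.indicator_of_mem h _]
        exact hG le_rfl hl₀
      · refine le_add_right (hG ?_ ?_)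
        · exact not_lt.1 h
        · refine (complexity_le hp).trans ?_
          exact hl.ge
    have hE : ∑' s : A, E s ≠ ∞ := by
      refine ne_top_of_le_ne_top ?_ (ENNReal.tsum_comp_le_tsum_of_injective
        (f := ((↑) : A → BinStr)) Subtype.val_injective E)
      rw [tsum_eq_sum (s := hD.toFinset) fun s hs => Set.indicator_of_notMem (by simpa using hs) _]
      refine ENNReal.sum_ne_top.2 fun s hs => ?_
      rw [Set.indicator_of_mem (by simpa using hs)]
      exact ENNReal.mul_ne_top (by simp) (by simp)
    rw [ENNReal.tsum_add] at htop
    exact (ENNReal.add_eq_top.1 htop).resolve_right hE
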